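/- Let $\mathbb K$ be $\mathbb R$ or $\mathbb C$. A pointed metric space is a metric space with a base point $0$ (for a normed space, the zero vector). $\mathrm{Lip}_0(X,Y)$ is the set of base-point preserving Lipschitz maps $X\to Y$, $\mathrm{Lip}(f)$ is the least Lipschitz constant of $f$, $X^\#=\mathrm{Lip}_0(X,\mathbb K)$ is a Banach space under $\mathrm{Lip}$, and $\mathcal F(X)\subseteq (X^\#)^*$ is the Lipschitz-free space, the closed linear span of the evaluations $\delta_X(x)\colon g\mapsto g(x)$, $x\in X$. **Lipschitz tensor products.** For a pointed metric space $X$ and a Banach space $E$, the space $X\boxtimes E$ is the linear span of the functionals $\delta_{(x,y)}\boxtimes e\colon f\mapsto\langle f(x)-f(y),e\rangle$ on $\mathrm{Lip}_0(X,E^*)$, where $x,y\in X$, $e\in E$. For $h\in\mathrm{Lip}_0(X,Y)$ and $T\in\mathcal L(E,F)$, $h\boxtimes T\colon X\boxtimes E\to Y\boxtimes F$ is the linear map with $\delta_{(x,y)}\boxtimes e\mapsto\delta_{(h(x),h(y))}\boxtimes Te$. For $u\in X\boxtimes E$ put $\pi(u)=\inf\{\sum_i d(x_i,y_i)\|e_i\|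 : u=\sum_i\delta_{(x_i,y_i)}\boxtimes e_i\}$ and $\varepsilon(u)=\sup\{|u(g\cdot\phi)| : \mathrm{Lip}(g)\le 1,\ \|\phi\|\le 1\}$, where $g\in X^\#$, $\phi\in E^*$ and $(g\cdot\phi)(x)=g(x)\phi$. A *generic Lipschitz cross-norm* $\alpha$ assigns to every pointed metric space $X$ and every Banach space $E$ a norm $\alpha(\cdot;X,E)$ on $X\boxtimes E$ such that $\alpha(\delta_{(x,y)}\boxtimes e)=d(x,y)\|e\|$, $\varepsilon\le\alpha\le\pi$, and $\alpha((h\boxtimes T)u)\le \mathrm{Lip}(h)\|T\|\alpha(u)$ for all $h\in \mathrm{Lip}_0(X,Y)$, $T\in\mathcal L(E,F)$ and $u\in X\boxtimes E$. It is *finitely generated* if $\alpha(u;X,E)=\inf\alpha(u;X_0,E_0)$ for all $u \in X\boxtimes E$, the infimum being over all finite $X_0\subseteq X$ with $0\in X_0$ and all finite-dimensional subspaces $E_0\subseteq E$ with $u\in X_0\boxtimes E_0$. The completion of $X\boxtimes E$ under $\alpha$ is denoted by $X\widehat\boxtimes_\alpha E$. **Ideals.** A *generic Lipschitz operator Banach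 ideal* $A$ assigns to every pointed metric space $X$ and every Banach space $E$ a linear subspace $A(X,E)$ of $\mathrm{Lip}_0(X,E)$ with a complete norm $\|\cdot\|_A\ge\mathrm{Lip}$ such that $g\cdot e\colon x\mapsto g(x)e$ is in $A(X,E)$ with $\|g\cdot e\|_A\le\mathrm{Lip}(g)\|e\|$ for all $g\in X^\#$, $e\in E$, and such that for $f\in A(X,E)$, $h\in\mathrm{Lip}_0(Z,X)$, $S\in\mathcal L(E,F)$ one has $Sfh\in A(Z,F)$ and $\|Sfh\|_A\le\|S\|\,\|f\|_A\,\mathrm{Lip}(h)$. It is *strong* if moreover for $f\in A(X,E)$, $h\in\mathrm{Lip}_0(Z,X)$ and $g\in\mathrm{Lip}_0(E,F)$ ($E,F$ Banach spaces) one has $gfh\in A(Z,F)$ and $\|gfh\|_A\le\mathrm{Lip}(g)\|f\|_A\mathrm{Lip}(h)$. For $f\in\mathrm{Lip}_0(X,E)$ let $\|f\|_{A^{\max}}\in[0,\infty]$ be the supremum of $\|Q_L\circ f|_Y\|_A$ over all finite $Y\subseteq X$ with $0\in Y$ and all closed finite-codimensional subspaces $L$ of $E$, with $Q_L\colon E\to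 E/L$ the quotient map; $A$ is *maximal* if for all $X$, $E$ and $f\in\mathrm{Lip}_0(X,E)$ one has $f\in A(X,E)$ if and only if $\|f\|_{A^{\max}}<\infty$, and then $\|f\|_A=\|f\|_{A^{\max}}$. $A$ and $\alpha$ are *associated* if, for every finite pointed metric space $X$ and every finite-dimensional Banach space $E$, a map $f\in\mathrm{Lip}_0(X,E^*)$ is in $A(X,E^*)$ if and only if there is $C\ge0$ with $|u(f)|\le C\alpha(u;X,E)$ for all $u\in X\boxtimes E$, and then $\|f\|_A$ is the least such $C$. A strong ideal $A$ is extended to maps between pointed metric spaces: $f\in\mathrm{Lip}_0(X,Y)$ is in $A(X,Y)$ if and only if $\delta_Y\circ f\in A(X,\mathcal F(Y))$, and then $\|f\|_A:=\|\delta_Y\circ f\|_A$. **Theorem.** Let $A$ be a strong and maximal generic Lipschitz operator Banach ideal, and let $\alpha$ be the finitely generated generic Lipschitz cross-norm associated to $A$. For any pointed metric spaces $X$, $Y$ and any $f\in\mathrm{Lip}_0(X,Y)$, the following are equivalent: 1. $f\in A(X,Y)$; 2. for every Banach space $G$, $f\boxtimes\mathrm{id}_G$ is continuous as a map $X\widehat\boxtimes_\alpha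 G\to Y\widehat\boxtimes_\pi G$ (that is, it extends to a continuous linear map between these completions); 3. $f\boxtimes\mathrm{id}_{Y^\#}$ is continuous as a map $X\widehat\boxtimes_\alpha Y^\#\to Y\widehat\boxtimes_\pi Y^\#$. In this case, for every Banach space $G$, $$\|f\|_A=\big\|f\boxtimes \mathrm{id}_{Y^\#}\colon X\widehat\boxtimes_\alpha Y^\#\to Y\widehat\boxtimes_\pi Y^\#\big\|\ \ge\ \big\|f\boxtimes\mathrm{id}_G\colon X\widehat\boxtimes_\alpha G\to Y\widehat\boxtimes_\pi G\big\|.$$ -/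

import Mathlib

universe u

noncomputable section

/-- For pointed metric spaces `X`, `Y` (the base point is the `0` given by the class `Zero`), the type
`Lip₀(X, Y)` of Lipschitz maps that preserve the base point. A normed space is a pointed metric
space with base point its zero vector. -/
structure Lip0 (X Y : Type*) [MetricSpace X] [Zero X] [MetricSpace Y] [Zero Y] where
  toFun : X → Y
  map_zero' : toFun 0 = 0
  lipschitz' : ∃ C : ℝ, 0 ≤ C ∧ ∀ x y, dist (toFun x) (toFun y) ≤ C * dist x y

namespace Lip0

section Metric

variable {X Y Z : Type*} [MetricSpace X] [Zero X] [MetricSpace Y] [Zero Y] [MetricSpace Z] [Zero Z]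

instance instFunLike : FunLike (Lip0 X Y) X Y where
  coe := Lip0.toFun
  coe_injective := by
    rintro ⟨f, _, _⟩ ⟨g, _, _⟩ h
    simpa using h

@[ext] theorem ext {f g : Lip0 X Y} (h : ∀ x, f x = g x) : f = g := DFunLike.ext _ _ h

@[simp] theorem map_zero (f : Lip0 X Y) : f 0 = 0 := f.map_zero'

@[simp] theorem mk_apply (f : X → Y) (h0 h1) (x : X) : (⟨f, h0, h1⟩ : Lip0 X Y) x = f x := rfl

/-- The least Lipschitz constant `Lip(f)`. -/
def lip (f : Lip0 X Y) : ℝ :=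
  sInf {C : ℝ | 0 ≤ C ∧ ∀ x y, dist (f x) (f y) ≤ C * dist x y}

theorem lip_nonneg (f : Lip0 X Y) : 0 ≤ f.lip := Real.sInf_nonneg fun _ h => h.1

theorem lip_le {f : Lip0 X Y} {C : ℝ} (hC : 0 ≤ C)
    (h : ∀ x y, dist (f x) (f y) ≤ C * dist x y) : f.lip ≤ C :=
  csInf_le ⟨0, fun _ h => h.1⟩ ⟨hC, h⟩

theorem dist_le (f : Lip0 X Y) (x y : X) : dist (f x) (f y) ≤ f.lip * dist x y := by
  rcases eq_or_ne x y with rfl | hxy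
  · simp
  · have hd : 0 < dist x y := dist_pos.2 hxy
    rw [← div_le_iff₀ hd]
    refine le_csInf f.lipschitz' ?_
    rintro C ⟨-, hC⟩
    rw [div_le_iff₀ hd]
    exact hC x y

/-- Composition `g ∘ f`. -/
def comp (g : Lip0 Y Z) (f : Lip0 X Y) : Lip0 X Z where
  toFun x := g (f x)
  map_zero' := by simp
  lipschitz' := by
    refine ⟨g.lip * f.lip, mul_nonneg g.lip_nonneg f.lip_nonneg, fun x y => ?_⟩
    calc dist (g (f x)) (g (f y)) ≤ g.lip * dist (f x) (f y) := g.dist_le _ _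
      _ ≤ g.lip * (f.lip * dist x y) :=
        mul_le_mul_of_nonneg_left (f.dist_le x y) g.lip_nonneg
      _ = _ := by ring

@[simp] theorem comp_apply (g : Lip0 Y Z) (f : Lip0 X Y) (x : X) : g.comp f x = g (f x) := rfl

end Metric

/-- The Lipschitz dual `X^# = Lip₀(X, 𝕜)`. -/
abbrev _root_.LipDual (𝕜 X : Type*) [RCLike 𝕜] [MetricSpace X] [Zero X] : Type _ := Lip0 X 𝕜

section Normed

variable {X E F : Type*} [MetricSpace X] [Zero X] [NormedAddCommGroup E] [NormedAddCommGroup F]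

theorem norm_sub_le (f : Lip0 X E) (x y : X) : ‖f x - f y‖ ≤ f.lip * dist x y := by
  simpa [dist_eq_norm] using f.dist_le x y

theorem norm_le (f : Lip0 X E) (x : X) : ‖f x‖ ≤ f.lip * dist x 0 := by
  simpa using f.norm_sub_le x 0

/-- A base-point preserving map into a normed group satisfying a Lipschitz estimate. -/
def mkNorm (f : X → E) (h0 : f 0 = 0) (C : ℝ) (hC : 0 ≤ C)
    (h : ∀ x y, ‖f x - f y‖ ≤ C * dist x y) : Lip0 X E :=
  ⟨f, h0, C, hC, fun x y => by simpa [dist_eq_norm] using h x y⟩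

@[simp] theorem mkNorm_apply (f : X → E) (h0 C hC h) (x : X) :
    (mkNorm f h0 C hC h : Lip0 X E) x = f x := rfl

instance : Zero (Lip0 X E) := ⟨mkNorm (fun _ => 0) rfl 0 le_rfl (by simp)⟩

instance : Add (Lip0 X E) :=
  ⟨fun f g => mkNorm (fun x => f x + g x) (by simp) (f.lip + g.lip)
    (add_nonneg f.lip_nonneg g.lip_nonneg) fun x y => by
      have h1 := f.norm_sub_le x y
      have h2 := g.norm_sub_le x y
      have h3 : f x + g x - (f y + g y) = (f x - f y) + (g x - g y) := by abel
      rw [h3, add_mul]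
      exact (norm_add_le _ _).trans (add_le_add h1 h2)⟩

instance : Neg (Lip0 X E) :=
  ⟨fun f => mkNorm (fun x => - f x) (by simp) f.lip f.lip_nonneg fun x y => by
      have h3 : - f x - - f y = -(f x - f y) := by abel
      rw [h3, norm_neg]
      exact f.norm_sub_le x y⟩

instance : Sub (Lip0 X E) :=
  ⟨fun f g => mkNorm (fun x => f x - g x) (by simp) (f.lip + g.lip)
    (add_nonneg f.lip_nonneg g.lip_nonneg) fun x y => by
      have h1 := f.norm_sub_le x y
      have h2 := g.norm_sub_le x y
      have h3 : f x - g x - (f y - g y) = (f x - f y) - (g x - g y) := by abel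
      rw [h3, add_mul]
      exact (_root_.norm_sub_le _ _).trans (add_le_add h1 h2)⟩

instance {𝕜 : Type*} [NormedField 𝕜] [NormedSpace 𝕜 E] : SMul 𝕜 (Lip0 X E) :=
  ⟨fun c f => mkNorm (fun x => c • f x) (by simp) (‖c‖ * f.lip)
    (mul_nonneg (norm_nonneg _) f.lip_nonneg) fun x y => by
      rw [← smul_sub, norm_smul, mul_assoc]
      exact mul_le_mul_of_nonneg_left (f.norm_sub_le x y) (norm_nonneg _)⟩

@[simp] theorem zero_apply (x : X) : (0 : Lip0 X E) x = 0 := rfl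
@[simp] theorem add_apply (f g : Lip0 X E) (x : X) : (f + g) x = f x + g x := rfl
@[simp] theorem neg_apply (f : Lip0 X E) (x : X) : (-f) x = -f x := rfl
@[simp] theorem sub_apply (f g : Lip0 X E) (x : X) : (f - g) x = f x - g x := rfl
@[simp] theorem smul_apply {𝕜 : Type*} [NormedField 𝕜] [NormedSpace 𝕜 E] (c : 𝕜)
    (f : Lip0 X E) (x : X) : (c • f) x = c • f x := rfl

instance : AddCommGroup (Lip0 X E) where
  add_assoc f g h := by ext x; simp [add_assoc]
  zero_add f := by ext x; simp
  add_zero f := by ext x; simp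
  add_comm f g := by ext x; simp [add_comm]
  neg_add_cancel f := by ext x; simp
  sub_eq_add_neg f g := by ext x; simp [sub_eq_add_neg]
  nsmul := nsmulRec
  zsmul := zsmulRec

instance {𝕜 : Type*} [NormedField 𝕜] [NormedSpace 𝕜 E] : Module 𝕜 (Lip0 X E) where
  one_smul f := by ext x; simp
  mul_smul a b f := by ext x; simp [mul_smul]
  smul_zero a := by ext x; simp
  smul_add a f g := by ext x; simp
  add_smul a b f := by ext x; simp [add_smul]
  zero_smul f := by ext x; simp

/-- `Lip₀(X, E)` carries the Lipschitz norm `Lip`. -/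
instance : NormedAddCommGroup (Lip0 X E) :=
  AddGroupNorm.toNormedAddCommGroup
    { toFun := lip
      map_zero' := le_antisymm (lip_le le_rfl (by simp)) (lip_nonneg _)
      add_le' := fun f g => lip_le (add_nonneg f.lip_nonneg g.lip_nonneg) fun x y => by
        have h3 : f x + g x - (f y + g y) = (f x - f y) + (g x - g y) := by abel
        rw [dist_eq_norm, add_apply, add_apply, h3, add_mul]
        exact (norm_add_le _ _).trans (add_le_add (f.norm_sub_le x y) (g.norm_sub_le x y))
      neg' := fun f => by
        simp only [lip, neg_apply, dist_neg_neg]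
      eq_zero_of_map_eq_zero' := fun f hf => by
        ext x
        have h := f.norm_le x
        rw [hf, zero_mul] at h
        simpa using h }

theorem norm_def (f : Lip0 X E) : ‖f‖ = f.lip := rfl

instance {𝕜 : Type*} [NormedField 𝕜] [NormedSpace 𝕜 E] : NormedSpace 𝕜 (Lip0 X E) where
  norm_smul_le c f := lip_le (mul_nonneg (norm_nonneg _) f.lip_nonneg) fun x y => by
    rw [dist_eq_norm, smul_apply, smul_apply, ← smul_sub, norm_smul, mul_assoc]
    exact mul_le_mul_of_nonneg_left (f.norm_sub_le x y) (norm_nonneg _)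

instance [CompleteSpace E] : CompleteSpace (Lip0 X E) := by
  refine Metric.complete_of_cauchySeq_tendsto fun v hv => ?_
  have hd : ∀ (f g : Lip0 X E) (x y : X),
      ‖(f x - f y) - (g x - g y)‖ ≤ dist f g * dist x y := fun f g x y => by
    have h := (f - g).norm_sub_le x y
    rw [dist_eq_norm, norm_def]
    have h3 : (f x - f y) - (g x - g y) = (f - g) x - (f - g) y := by
      simp only [sub_apply]; abel
    rw [h3]; exact h
  have hx : ∀ x, CauchySeq fun n => v n x := fun x => by
    rw [Metric.cauchySeq_iff'] at hv ⊢
    intro ε hε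
    obtain ⟨N, hN⟩ := hv (ε / (dist x 0 + 1)) (by positivity)
    refine ⟨N, fun n hn => ?_⟩
    have h1 := hd (v n) (v N) x 0
    have h2 := hN n hn
    rw [dist_eq_norm]
    simp only [map_zero, sub_zero] at h1
    have hpos : 0 < dist x 0 + 1 := by positivity
    calc ‖v n x - v N x‖ ≤ dist (v n) (v N) * dist x 0 := h1
      _ ≤ dist (v n) (v N) * (dist x 0 + 1) :=
        mul_le_mul_of_nonneg_left (by linarith) dist_nonneg
      _ < ε := by rwa [lt_div_iff₀ hpos] at h2
  choose g hg using fun x => cauchySeq_tendsto_of_complete (hx x)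
  have key : ∀ ε > 0, ∃ N, ∀ n ≥ N, ∀ x y,
      ‖(v n x - v n y) - (g x - g y)‖ ≤ ε * dist x y := by
    intro ε hε
    obtain ⟨N, hN⟩ := Metric.cauchySeq_iff.1 hv ε hε
    refine ⟨N, fun n hn x y => ?_⟩
    have ht : Filter.Tendsto (fun m => ‖(v n x - v n y) - (v m x - v m y)‖) Filter.atTop
        (nhds ‖(v n x - v n y) - (g x - g y)‖) :=
      (tendsto_const_nhds.sub ((hg x).sub (hg y))).norm
    refine le_of_tendsto ht (Filter.eventually_atTop.2 ⟨N, fun m hm => ?_⟩)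
    exact (hd _ _ x y).trans
      (mul_le_mul_of_nonneg_right (hN n hn m hm).le dist_nonneg)
  have hg0 : g 0 = 0 := by
    refine tendsto_nhds_unique (hg 0) ?_
    simp
  obtain ⟨N, hN⟩ := key 1 one_pos
  have hgl : ∀ x y, ‖g x - g y‖ ≤ ((v N).lip + 1) * dist x y := fun x y => by
    have h1 := hN N le_rfl x y
    have h2 := (v N).norm_sub_le x y
    have h3 := norm_sub_norm_le (g x - g y) (v N x - v N y)
    rw [norm_sub_rev (g x - g y)] at h3
    linarith [add_mul (v N).lip 1 (dist x y)]
  let G : Lip0 X E := mkNorm g hg0 ((v N).lip + 1) (add_nonneg (lip_nonneg _) zero_le_one) hgl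
  refine ⟨G, Metric.tendsto_atTop.2 fun ε hε => ?_⟩
  obtain ⟨M, hM⟩ := key (ε / 2) (half_pos hε)
  refine ⟨M, fun n hn => lt_of_le_of_lt ?_ (half_lt_self hε)⟩
  rw [dist_eq_norm]
  refine lip_le (half_pos hε).le fun x y => ?_
  rw [dist_eq_norm]
  have h3 : (v n - G) x - (v n - G) y = (v n x - v n y) - (g x - g y) := by
    simp only [sub_apply, G, mkNorm_apply]; abel
  rw [h3]
  exact hM n hn x y

instance instNormedAddCommGroupLipDual {𝕜 : Type*} [RCLike 𝕜] :
    NormedAddCommGroup (LipDual 𝕜 X) := inferInstance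

instance instNormedSpaceLipDual {𝕜 : Type*} [RCLike 𝕜] :
    NormedSpace 𝕜 (LipDual 𝕜 X) := inferInstance

variable {𝕜 : Type*} [RCLike 𝕜] [NormedSpace 𝕜 E] [NormedSpace 𝕜 F]

/-- A bounded linear operator, as a base-point preserving Lipschitz map. -/
def ofCLM (T : E →L[𝕜] F) : Lip0 E F :=
  mkNorm T (_root_.map_zero T) ‖T‖ (norm_nonneg _) fun x y => by
    rw [← map_sub, dist_eq_norm]; exact T.le_opNorm _

@[simp] theorem ofCLM_apply (T : E →L[𝕜] F) (e : E) : ofCLM T e = T e := rfl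

/-- The rank-one operator `g · e : x ↦ g(x) e`, for `g ∈ X^#` and `e ∈ E`. -/
def rankOne (g : LipDual 𝕜 X) (e : E) : Lip0 X E :=
  mkNorm (fun x => g x • e) (by simp) (g.lip * ‖e‖) (mul_nonneg g.lip_nonneg (norm_nonneg _))
    fun x y => by
      rw [← sub_smul, norm_smul, mul_right_comm]
      exact mul_le_mul_of_nonneg_right (g.norm_sub_le x y) (norm_nonneg _)

@[simp] theorem rankOne_apply (g : LipDual 𝕜 X) (e : E) (x : X) : rankOne g e x = g x • e := rfl

end Normed

end Lip0

/-! ### Lipschitz-free spaces -/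

section Free

variable (𝕜 : Type*) [RCLike 𝕜] (Y : Type*) [MetricSpace Y] [Zero Y]

/-- The evaluation functional at `y`, an element of the dual of `Y^# = Lip₀(Y, 𝕜)`. -/
def lipEval (y : Y) : StrongDual 𝕜 (LipDual 𝕜 Y) :=
  LinearMap.mkContinuous
    { toFun := fun g => g y
      map_add' := fun _ _ => rfl
      map_smul' := fun _ _ => rfl } (dist y 0) fun g => by
    have h := g.norm_le y
    rw [mul_comm] at h
    exact h

@[simp] theorem lipEval_apply (y : Y) (g : LipDual 𝕜 Y) : lipEval 𝕜 Y y g = g y := rfl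

/-- The closed linear span of the evaluation functionals in the dual of `Y^#`. -/
def freeSubmodule : Submodule 𝕜 (StrongDual 𝕜 (LipDual 𝕜 Y)) :=
  (Submodule.span 𝕜 (Set.range (lipEval 𝕜 Y))).topologicalClosure

/-- The Lipschitz-free Banach space `𝓕(Y)`. -/
def FreeSpace : Type _ := freeSubmodule 𝕜 Y

instance : NormedAddCommGroup (FreeSpace 𝕜 Y) :=
  inferInstanceAs (NormedAddCommGroup (freeSubmodule 𝕜 Y))

instance : NormedSpace 𝕜 (FreeSpace 𝕜 Y) :=
  inferInstanceAs (NormedSpace 𝕜 (freeSubmodule 𝕜 Y))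

instance : CompleteSpace (FreeSpace 𝕜 Y) :=
  (Submodule.isClosed_topologicalClosure
    (Submodule.span 𝕜 (Set.range (lipEval 𝕜 Y)))).completeSpace_coe

/-- The canonical embedding `δ_Y : Y → 𝓕(Y)`. -/
def freeEmb : Lip0 Y (FreeSpace 𝕜 Y) :=
  Lip0.mkNorm
    (fun y => ⟨lipEval 𝕜 Y y, Submodule.le_topologicalClosure _
      (Submodule.subset_span (Set.mem_range_self y))⟩)
    (by
      apply Subtype.ext
      change lipEval 𝕜 Y 0 = 0
      ext g
      simp) 1 zero_le_one fun x y => by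
      rw [one_mul]
      change ‖lipEval 𝕜 Y x - lipEval 𝕜 Y y‖ ≤ dist x y
      refine ContinuousLinearMap.opNorm_le_bound _ dist_nonneg fun g => ?_
      have h := g.norm_sub_le x y
      rw [mul_comm] at h
      exact h

end Free

/-! ### Lipschitz tensor products -/

section Tensor

variable (𝕜 : Type*) [RCLike 𝕜] (X E : Type*) [MetricSpace X] [Zero X] [NormedAddCommGroup E]
  [NormedSpace 𝕜 E]

variable {X E} in
/-- The functional `δ_(x,y) ⊠ e` on `Lip₀(X, E*)`, `f ↦ ⟨f x - f y, e⟩`. -/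
def elemTensor (x y : X) (e : E) : Module.Dual 𝕜 (Lip0 X (StrongDual 𝕜 E)) where
  toFun f := (f x - f y) e
  map_add' f g := by simp; ring
  map_smul' c f := by simp; ring

/-- The Lipschitz tensor product `X ⊠ E`: the linear span of the functionals `δ_(x,y) ⊠ e` in the
algebraic dual of `Lip₀(X, E*)`. -/
def lipTensor : Submodule 𝕜 (Module.Dual 𝕜 (Lip0 X (StrongDual 𝕜 E))) :=
  Submodule.span 𝕜 {φ | ∃ (x y : X) (e : E), φ = elemTensor 𝕜 x y e}

/-- The type of elements of `X ⊠ E`. -/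
abbrev LipTensor : Type _ := lipTensor 𝕜 X E

variable {X E} in
/-- `δ_(x,y) ⊠ e` as an element of `X ⊠ E`. -/
def LipTensor.mk (x y : X) (e : E) : LipTensor 𝕜 X E :=
  ⟨elemTensor 𝕜 x y e, Submodule.subset_span ⟨x, y, e, rfl⟩⟩

variable {𝕜 X E}

@[simp] theorem elemTensor_apply (x y : X) (e : E) (f : Lip0 X (StrongDual 𝕜 E)) :
    elemTensor 𝕜 x y e f = f x e - f y e := by simp [elemTensor]

@[simp] theorem LipTensor.mk_coe_apply (x y : X) (e : E) (f : Lip0 X (StrongDual 𝕜 E)) :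
    (LipTensor.mk 𝕜 x y e).1 f = f x e - f y e := elemTensor_apply x y e f

/-- `r` is the value `∑ d(xᵢ,yᵢ)‖eᵢ‖` of some representation `u = ∑ δ_(xᵢ,yᵢ) ⊠ eᵢ`. -/
def LipTensor.IsRepValue (u : LipTensor 𝕜 X E) (r : ℝ) : Prop :=
  ∃ (n : ℕ) (x y : Fin n → X) (e : Fin n → E),
    u = ∑ i, LipTensor.mk 𝕜 (x i) (y i) (e i) ∧ r = ∑ i, dist (x i) (y i) * ‖e i‖

/-- The Lipschitz projective norm `π`. -/
def LipTensor.projNorm (u : LipTensor 𝕜 X E) : ℝ := sInf {r | u.IsRepValue r}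

/-- The Lipschitz injective norm `ε`; if `u = ∑ δ_(xᵢ,yᵢ) ⊠ eᵢ` then
`u (g · φ) = ∑ (g xᵢ - g yᵢ) ⟨φ, eᵢ⟩`. -/
def LipTensor.injNorm (u : LipTensor 𝕜 X E) : ℝ :=
  sSup {r | ∃ (g : LipDual 𝕜 X) (φ : StrongDual 𝕜 E), g.lip ≤ 1 ∧ ‖φ‖ ≤ 1 ∧
    r = ‖u.1 (Lip0.rankOne g φ)‖}

section Map

variable {Y F : Type*} [MetricSpace Y] [Zero Y] [NormedAddCommGroup F] [NormedSpace 𝕜 F]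

/-- The linear map `g ↦ T* ∘ g ∘ h` from `Lip₀(Y, F*)` to `Lip₀(X, E*)`. -/
def Lip0.pullback (h : Lip0 X Y) (T : E →L[𝕜] F) :
    Lip0 Y (StrongDual 𝕜 F) →ₗ[𝕜] Lip0 X (StrongDual 𝕜 E) where
  toFun g := Lip0.mkNorm (fun x => (g (h x)).comp T) (by simp) (g.lip * h.lip * ‖T‖)
    (by have := g.lip_nonneg; have := h.lip_nonneg; positivity) fun x y => by
      have h1 : ((g (h x)).comp T - (g (h y)).comp T) = (g (h x) - g (h y)).comp T := by
        ext; simp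
      have h2 : ‖g (h x) - g (h y)‖ ≤ g.lip * h.lip * dist x y := by
        have := (g.comp h).lip_nonneg
        calc _ ≤ g.lip * dist (h x) (h y) := g.norm_sub_le _ _
          _ ≤ g.lip * (h.lip * dist x y) :=
            mul_le_mul_of_nonneg_left (h.dist_le x y) g.lip_nonneg
          _ = _ := by ring
      rw [h1]
      calc _ ≤ ‖g (h x) - g (h y)‖ * ‖T‖ := ContinuousLinearMap.opNorm_comp_le _ _
        _ ≤ (g.lip * h.lip * dist x y) * ‖T‖ := mul_le_mul_of_nonneg_right h2 (norm_nonneg _)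
        _ = _ := by ring
  map_add' f g := by ext; simp
  map_smul' c f := by ext; simp

@[simp] theorem Lip0.pullback_apply (h : Lip0 X Y) (T : E →L[𝕜] F) (g : Lip0 Y (StrongDual 𝕜 F))
    (x : X) (e : E) : Lip0.pullback h T g x e = g (h x) (T e) := rfl

theorem elemTensor_comp_pullback (h : Lip0 X Y) (T : E →L[𝕜] F) (x y : X) (e : E) :
    (Lip0.pullback h T).dualMap (elemTensor 𝕜 x y e) = elemTensor 𝕜 (h x) (h y) (T e) := by
  ext g; simp

/-- The linear map `h ⊠ T : X ⊠ E → Y ⊠ F`, determined by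
`δ_(x,y) ⊠ e ↦ δ_(h x, h y) ⊠ T e` (see `LipTensor.map_mk`). -/
def LipTensor.map (h : Lip0 X Y) (T : E →L[𝕜] F) : LipTensor 𝕜 X E →ₗ[𝕜] LipTensor 𝕜 Y F :=
  (Lip0.pullback h T).dualMap.restrict (p := lipTensor 𝕜 X E) (q := lipTensor 𝕜 Y F) <| by
    intro u hu
    induction hu using Submodule.span_induction with
    | mem φ hφ =>
      obtain ⟨x, y, e, rfl⟩ := hφ
      rw [elemTensor_comp_pullback]
      exact (LipTensor.mk 𝕜 (h x) (h y) (T e)).2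
    | zero => rw [_root_.map_zero]; exact Submodule.zero_mem _
    | add a b _ _ ha hb => rw [map_add]; exact Submodule.add_mem _ ha hb
    | smul c a _ ha => rw [map_smul]; exact Submodule.smul_mem _ c ha

@[simp] theorem LipTensor.map_mk (h : Lip0 X Y) (T : E →L[𝕜] F) (x y : X) (e : E) :
    LipTensor.map h T (LipTensor.mk 𝕜 x y e) = LipTensor.mk 𝕜 (h x) (h y) (T e) :=
  Subtype.ext (elemTensor_comp_pullback h T x y e)

end Map

variable (𝕜 X E) in
/-- A Lipschitz cross-norm on `X ⊠ E`: a norm with `α(δ_(x,y) ⊠ e) = d(x,y) ‖e‖`. -/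
structure LipCrossNorm where
  toSeminorm : Seminorm 𝕜 (LipTensor 𝕜 X E)
  eq_zero' : ∀ u, toSeminorm u = 0 → u = 0
  cross' : ∀ (x y : X) (e : E), toSeminorm (LipTensor.mk 𝕜 x y e) = dist x y * ‖e‖

instance : CoeFun (LipCrossNorm 𝕜 X E) fun _ => LipTensor 𝕜 X E → ℝ := ⟨fun α u => α.toSeminorm u⟩

/-! The projective norm is a Lipschitz cross-norm. -/

theorem LipTensor.exists_repValue (u : LipTensor 𝕜 X E) : ∃ r, u.IsRepValue r := by
  obtain ⟨u, hu⟩ := u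
  induction hu using Submodule.span_induction with
  | mem φ hφ =>
    obtain ⟨x, y, e, rfl⟩ := hφ
    exact ⟨_, 1, fun _ => x, fun _ => y, fun _ => e, by simp [LipTensor.mk], rfl⟩
  | zero => exact ⟨_, 0, fun i => i.elim0, fun i => i.elim0, fun i => i.elim0, by simp; rfl, rfl⟩
  | add a b ha hb iha ihb =>
    obtain ⟨-, n, x, y, e, h, -⟩ := iha
    obtain ⟨-, m, x', y', e', h', -⟩ := ihb
    refine ⟨_, n + m, Fin.append x x', Fin.append y y', Fin.append e e', ?_, rfl⟩
    rw [Fin.sum_univ_add]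
    simp only [Fin.append_left, Fin.append_right, ← h, ← h']
    rfl
  | smul c a ha iha =>
    obtain ⟨-, n, x, y, e, h, -⟩ := iha
    refine ⟨_, n, x, y, fun i => c • e i, ?_, rfl⟩
    have h2 : (⟨c • a, Submodule.smul_mem _ c ha⟩ : LipTensor 𝕜 X E) = c • ⟨a, ha⟩ := rfl
    rw [h2, h, Finset.smul_sum]
    refine Finset.sum_congr rfl fun i _ => Subtype.ext ?_
    ext f
    simp [mul_sub]

theorem LipTensor.IsRepValue.nonneg {u : LipTensor 𝕜 X E} {r : ℝ} (h : u.IsRepValue r) : 0 ≤ r := by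
  obtain ⟨n, x, y, e, -, rfl⟩ := h
  positivity

theorem LipTensor.projNorm_nonneg (u : LipTensor 𝕜 X E) : 0 ≤ u.projNorm :=
  Real.sInf_nonneg fun _ h => h.nonneg

theorem LipTensor.projNorm_le {u : LipTensor 𝕜 X E} {r : ℝ} (h : u.IsRepValue r) :
    u.projNorm ≤ r :=
  csInf_le ⟨0, fun _ h => h.nonneg⟩ h

theorem LipTensor.norm_apply_le_projNorm (u : LipTensor 𝕜 X E) (f : Lip0 X (StrongDual 𝕜 E)) :
    ‖u.1 f‖ ≤ f.lip * u.projNorm := by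
  have h1 : ∀ r, u.IsRepValue r → ‖u.1 f‖ ≤ f.lip * r := by
    rintro r ⟨n, x, y, e, rfl, rfl⟩
    rw [Finset.mul_sum, AddSubmonoidClass.coe_finsetSum, LinearMap.sum_apply]
    refine (norm_sum_le _ _).trans (Finset.sum_le_sum fun i _ => ?_)
    rw [LipTensor.mk_coe_apply, ← sub_apply, ← mul_assoc]
    exact (ContinuousLinearMap.le_opNorm _ _).trans
      (mul_le_mul_of_nonneg_right (f.norm_sub_le _ _) (norm_nonneg _))
  rcases f.lip_nonneg.eq_or_lt with h | h
  · obtain ⟨r, hr⟩ := u.exists_repValue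
    simpa [← h] using h1 r hr
  · rw [← div_le_iff₀' h]
    refine le_csInf u.exists_repValue fun r hr => ?_
    rw [div_le_iff₀' h]
    exact h1 r hr

theorem LipTensor.projNorm_add_le (u v : LipTensor 𝕜 X E) :
    (u + v).projNorm ≤ u.projNorm + v.projNorm := by
  refine le_of_forall_pos_le_add fun ε hε => ?_
  obtain ⟨r, hr, hr'⟩ := exists_lt_of_csInf_lt (s := {r | u.IsRepValue r}) u.exists_repValue
    (show u.projNorm < u.projNorm + ε / 2 by linarith)
  obtain ⟨s, hs, hs'⟩ := exists_lt_of_csInf_lt (s := {r | v.IsRepValue r}) v.exists_repValue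
    (show v.projNorm < v.projNorm + ε / 2 by linarith)
  have h : (u + v).IsRepValue (r + s) := by
    obtain ⟨n, x, y, e, h, rfl⟩ := hr
    obtain ⟨m, x', y', e', h', rfl⟩ := hs
    refine ⟨n + m, Fin.append x x', Fin.append y y', Fin.append e e', ?_, ?_⟩ <;>
      rw [Fin.sum_univ_add] <;> simp only [Fin.append_left, Fin.append_right, ← h, ← h']
  linarith [LipTensor.projNorm_le h]

theorem LipTensor.projNorm_smul_le (c : 𝕜) (u : LipTensor 𝕜 X E) :
    (c • u).projNorm ≤ ‖c‖ * u.projNorm := by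
  have h1 : ∀ r, u.IsRepValue r → (c • u).projNorm ≤ ‖c‖ * r := by
    rintro r ⟨n, x, y, e, rfl, rfl⟩
    refine LipTensor.projNorm_le ⟨n, x, y, fun i => c • e i, ?_, ?_⟩
    · rw [Finset.smul_sum]
      refine Finset.sum_congr rfl fun i _ => Subtype.ext ?_
      ext f
      simp [mul_sub]
    · rw [Finset.mul_sum]
      refine Finset.sum_congr rfl fun i _ => ?_
      rw [norm_smul]; ring
  rcases (norm_nonneg c).eq_or_lt with h | h
  · obtain ⟨r, hr⟩ := u.exists_repValue
    simpa [← h] using h1 r hr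
  · rw [← div_le_iff₀' h]
    refine le_csInf u.exists_repValue fun r hr => ?_
    rw [div_le_iff₀' h]
    exact h1 r hr

theorem LipTensor.projNorm_mk (x y : X) (e : E) :
    (LipTensor.mk 𝕜 x y e).projNorm = dist x y * ‖e‖ := by
  refine le_antisymm
    (LipTensor.projNorm_le ⟨1, fun _ => x, fun _ => y, fun _ => e, by simp, by simp⟩) ?_
  obtain ⟨φ, hφ, hφe⟩ := exists_dual_vector'' 𝕜 e
  let g : LipDual 𝕜 X := Lip0.mkNorm (fun z => ((dist z y - dist 0 y : ℝ) : 𝕜)) (by simp) 1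
    zero_le_one fun z w => by
      rw [← RCLike.ofReal_sub, RCLike.norm_ofReal, one_mul]
      have h3 : dist z y - dist 0 y - (dist w y - dist 0 y) = dist z y - dist w y := by ring
      rw [h3]
      exact abs_dist_sub_le z w y
  have hg : g.lip ≤ 1 := Lip0.lip_le zero_le_one fun z w => by
    rw [dist_eq_norm, one_mul]
    simp only [g, Lip0.mkNorm_apply, ← RCLike.ofReal_sub, RCLike.norm_ofReal]
    have h3 : dist z y - dist 0 y - (dist w y - dist 0 y) = dist z y - dist w y := by ring
    rw [h3]
    exact abs_dist_sub_le z w y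
  have hl : (Lip0.rankOne g φ).lip ≤ 1 := Lip0.lip_le zero_le_one fun z w => by
    rw [dist_eq_norm, Lip0.rankOne_apply, Lip0.rankOne_apply, ← sub_smul, norm_smul]
    calc _ ≤ ‖g z - g w‖ * 1 := mul_le_mul_of_nonneg_left hφ (norm_nonneg _)
      _ ≤ g.lip * dist z w := by rw [mul_one]; exact g.norm_sub_le z w
      _ ≤ _ := mul_le_mul_of_nonneg_right hg dist_nonneg
  have h := LipTensor.norm_apply_le_projNorm (LipTensor.mk 𝕜 x y e) (Lip0.rankOne g φ)
  have h2 : (LipTensor.mk 𝕜 x y e).1 (Lip0.rankOne g φ) = ((dist x y * ‖e‖ : ℝ) : 𝕜) := by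
    rw [LipTensor.mk_coe_apply]
    simp only [Lip0.rankOne_apply, smul_apply, hφe, smul_eq_mul, g,
      Lip0.mkNorm_apply, dist_self]
    push_cast
    ring
  rw [h2, RCLike.norm_ofReal, abs_of_nonneg (by positivity)] at h
  refine h.trans ?_
  calc _ ≤ 1 * _ := mul_le_mul_of_nonneg_right hl (LipTensor.projNorm_nonneg _)
    _ = _ := one_mul _

variable (𝕜 X E) in
/-- The Lipschitz projective norm `π` as a Lipschitz cross-norm on `X ⊠ E`. -/
def LipCrossNorm.proj : LipCrossNorm 𝕜 X E where
  toSeminorm := Seminorm.ofSMulLE LipTensor.projNorm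
    (le_antisymm (LipTensor.projNorm_le ⟨0, fun i => i.elim0, fun i => i.elim0, fun i => i.elim0,
      by simp, by simp⟩) (LipTensor.projNorm_nonneg _))
    LipTensor.projNorm_add_le LipTensor.projNorm_smul_le
  eq_zero' u hu := by
    refine Subtype.ext (LinearMap.ext fun f => ?_)
    have h := LipTensor.norm_apply_le_projNorm u f
    have hu' : u.projNorm = 0 := hu
    rw [hu', mul_zero] at h
    simpa using h
  cross' := LipTensor.projNorm_mk

/-- The normed space `X ⊠_α E`. -/
def LipTensorNormed (_ : LipCrossNorm 𝕜 X E) : Type _ := LipTensor 𝕜 X E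

namespace LipTensorNormed

variable (α : LipCrossNorm 𝕜 X E)

instance : AddCommGroup (LipTensorNormed α) := inferInstanceAs (AddCommGroup (LipTensor 𝕜 X E))

instance : Module 𝕜 (LipTensorNormed α) := inferInstanceAs (Module 𝕜 (LipTensor 𝕜 X E))

/-- The identity map from `X ⊠ E` to `X ⊠_α E`. -/
def of : LipTensor 𝕜 X E ≃ₗ[𝕜] LipTensorNormed α := LinearEquiv.refl 𝕜 (LipTensor 𝕜 X E)

instance : NormedAddCommGroup (LipTensorNormed α) :=
  AddGroupNorm.toNormedAddCommGroup
    { toFun := fun u => α ((of α).symm u)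
      map_zero' := by simp
      add_le' := fun u v => by rw [map_add]; exact map_add_le_add _ _ _
      neg' := fun u => by rw [map_neg]; exact map_neg_eq_map _ _
      eq_zero_of_map_eq_zero' := fun u hu => α.eq_zero' u hu }

theorem norm_of (u : LipTensor 𝕜 X E) : ‖of α u‖ = α u := rfl

instance : NormedSpace 𝕜 (LipTensorNormed α) where
  norm_smul_le c u := (map_smul_eq_mul α.toSeminorm c ((of α).symm u)).le

end LipTensorNormed

/-- The completion of `X ⊠_α E`. -/
abbrev LipTensorCompl (α : LipCrossNorm 𝕜 X E) : Type _ :=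
  UniformSpace.Completion (LipTensorNormed α)

/-- The canonical map from `X ⊠ E` into the completion of `X ⊠_α E`. -/
def LipTensorCompl.of (α : LipCrossNorm 𝕜 X E) (u : LipTensor 𝕜 X E) :
    LipTensorCompl α :=
  ((LipTensorNormed.of α u : LipTensorNormed α) : UniformSpace.Completion (LipTensorNormed α))

/-- `T` is the continuous linear extension to the completions of `h ⊠ S : X ⊠ E → Y ⊠ F`.
Such a `T` is unique; it exists if and only if `h ⊠ S` is continuous for the norms `α`, `β`, and
then its norm is the norm of `h ⊠ S`. -/
def IsTensorExtension {Y F : Type*} [MetricSpace Y] [Zero Y] [NormedAddCommGroup F]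
    [NormedSpace 𝕜 F] (α : LipCrossNorm 𝕜 X E) (β : LipCrossNorm 𝕜 Y F) (h : Lip0 X Y)
    (S : E →L[𝕜] F) (T : LipTensorCompl α →L[𝕜] LipTensorCompl β) : Prop :=
  ∀ u : LipTensor 𝕜 X E, T (LipTensorCompl.of α u) = LipTensorCompl.of β (LipTensor.map h S u)

/-- `C ≥ 0` satisfies `|u(f)| ≤ C α(u)` for all `u ∈ X ⊠ E`. -/
def LipCrossNorm.IsLipBound (α : LipCrossNorm 𝕜 X E) (f : Lip0 X (StrongDual 𝕜 E)) (C : ℝ) : Prop :=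
  0 ≤ C ∧ ∀ u : LipTensor 𝕜 X E, ‖u.1 f‖ ≤ C * α u

/-- The `α`-Lipschitz norm `Lip_α(f)` (meaningful if some `C` is a bound). -/
def LipCrossNorm.lipNorm (α : LipCrossNorm 𝕜 X E) (f : Lip0 X (StrongDual 𝕜 E)) : ℝ :=
  sInf {C | α.IsLipBound f C}

end Tensor

/-! ### Finite pointed subsets, finite-dimensional and finite-codimensional subspaces -/

/-- `MFIN(X)`: the finite subsets of `X` that contain the base point. -/
structure MFin (X : Type*) [Zero X] where
  carrier : Set X
  finite' : carrier.Finite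
  zero_mem' : (0 : X) ∈ carrier

namespace MFin

variable {X : Type*} [MetricSpace X] [Zero X]

instance : CoeSort (MFin X) (Type _) := ⟨fun Y => Y.carrier⟩

instance (Y : MFin X) : Zero Y := ⟨⟨0, Y.zero_mem'⟩⟩

instance (Y : MFin X) : Finite Y := Y.finite'

/-- The inclusion `I : Y → X`. -/
def incl (Y : MFin X) : Lip0 Y X where
  toFun y := y
  map_zero' := rfl
  lipschitz' := ⟨1, zero_le_one, fun x y => by rw [one_mul]; rfl⟩

end MFin

/-- `FIN(E)`: the finite-dimensional subspaces of `E`. -/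
structure FinSub (𝕜 E : Type*) [RCLike 𝕜] [NormedAddCommGroup E] [NormedSpace 𝕜 E] where
  carrier : Submodule 𝕜 E
  finite' : FiniteDimensional 𝕜 carrier

namespace FinSub

variable {𝕜 E : Type*} [RCLike 𝕜] [NormedAddCommGroup E] [NormedSpace 𝕜 E]

instance : CoeSort (FinSub 𝕜 E) (Type _) := ⟨fun M => M.carrier⟩

instance (M : FinSub 𝕜 E) : FiniteDimensional 𝕜 M := M.finite'

instance (M : FinSub 𝕜 E) : CompleteSpace M := FiniteDimensional.complete 𝕜 M

end FinSub

/-- `COFIN(E)`: the closed subspaces of `E` of finite codimension. -/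
structure CofinSub (𝕜 E : Type*) [RCLike 𝕜] [NormedAddCommGroup E] [NormedSpace 𝕜 E] where
  carrier : Submodule 𝕜 E
  closed' : IsClosed (carrier : Set E)
  finite' : FiniteDimensional 𝕜 (E ⧸ carrier)

namespace CofinSub

variable {𝕜 E : Type*} [RCLike 𝕜] [NormedAddCommGroup E] [NormedSpace 𝕜 E]

instance (L : CofinSub 𝕜 E) : IsClosed (L.carrier : Set E) := L.closed'

instance (L : CofinSub 𝕜 E) : FiniteDimensional 𝕜 (E ⧸ L.carrier) := L.finite'

/-- The canonical projection `Q : E → E/L`. -/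
def proj (L : CofinSub 𝕜 E) : E →L[𝕜] E ⧸ L.carrier := L.carrier.mkQL

end CofinSub

/-! ### Generic Lipschitz cross-norms and generic Lipschitz operator Banach ideals -/

/-- A generic Lipschitz cross-norm: a dualizable Lipschitz cross-norm on `X ⊠ E` for all pointed
metric spaces `X` and Banach spaces `E`, with the metric mapping property. -/
structure GenericLipCrossNorm (𝕜 : Type) [RCLike 𝕜] where
  norm : ∀ (X : Type u) [MetricSpace X] [Zero X] (E : Type u) [NormedAddCommGroup E]
    [NormedSpace 𝕜 E] [CompleteSpace E], LipCrossNorm 𝕜 X E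
  injNorm_le : ∀ (X : Type u) [MetricSpace X] [Zero X] (E : Type u) [NormedAddCommGroup E]
    [NormedSpace 𝕜 E] [CompleteSpace E] (u : LipTensor 𝕜 X E), u.injNorm ≤ norm X E u
  le_projNorm : ∀ (X : Type u) [MetricSpace X] [Zero X] (E : Type u) [NormedAddCommGroup E]
    [NormedSpace 𝕜 E] [CompleteSpace E] (u : LipTensor 𝕜 X E), norm X E u ≤ u.projNorm
  metric_mapping : ∀ (X Y : Type u) [MetricSpace X] [Zero X] [MetricSpace Y] [Zero Y]
    (E F : Type u) [NormedAddCommGroup E] [NormedSpace 𝕜 E] [CompleteSpace E]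
    [NormedAddCommGroup F] [NormedSpace 𝕜 F] [CompleteSpace F]
    (h : Lip0 X Y) (T : E →L[𝕜] F) (u : LipTensor 𝕜 X E),
    norm Y F (LipTensor.map h T u) ≤ h.lip * ‖T‖ * norm X E u

/-- `α(u; X, E)` is the infimum of `α(u; X₀, E₀)` over the finite pointed `X₀ ⊆ X` and the
finite-dimensional `E₀ ⊆ E` with `u ∈ X₀ ⊠ E₀`. -/
def GenericLipCrossNorm.FinitelyGenerated {𝕜 : Type} [RCLike 𝕜]
    (α : GenericLipCrossNorm.{u} 𝕜) : Prop :=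
  ∀ (X : Type u) [MetricSpace X] [Zero X] (E : Type u) [NormedAddCommGroup E] [NormedSpace 𝕜 E]
    [CompleteSpace E] (u : LipTensor 𝕜 X E),
    α.norm X E u = sInf {r : ℝ | ∃ (X₀ : MFin X) (E₀ : FinSub 𝕜 E) (u₀ : LipTensor 𝕜 X₀ E₀),
      LipTensor.map X₀.incl E₀.carrier.subtypeL u₀ = u ∧ r = α.norm X₀ E₀ u₀}

/-- A generic Lipschitz operator Banach ideal. -/
structure GenericLipIdeal (𝕜 : Type) [RCLike 𝕜] where
  carrier : ∀ (X : Type u) [MetricSpace X] [Zero X] (E : Type u) [NormedAddCommGroup E]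
    [NormedSpace 𝕜 E] [CompleteSpace E], Submodule 𝕜 (Lip0 X E)
  norm : ∀ (X : Type u) [MetricSpace X] [Zero X] (E : Type u) [NormedAddCommGroup E]
    [NormedSpace 𝕜 E] [CompleteSpace E], Seminorm 𝕜 (carrier X E)
  eq_zero : ∀ (X : Type u) [MetricSpace X] [Zero X] (E : Type u) [NormedAddCommGroup E]
    [NormedSpace 𝕜 E] [CompleteSpace E] (f : carrier X E), norm X E f = 0 → f = 0
  rankOne_mem : ∀ (X : Type u) [MetricSpace X] [Zero X] (E : Type u) [NormedAddCommGroup E]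
    [NormedSpace 𝕜 E] [CompleteSpace E] (g : LipDual 𝕜 X) (e : E), Lip0.rankOne g e ∈ carrier X E
  norm_rankOne_le : ∀ (X : Type u) [MetricSpace X] [Zero X] (E : Type u) [NormedAddCommGroup E]
    [NormedSpace 𝕜 E] [CompleteSpace E] (g : LipDual 𝕜 X) (e : E),
    norm X E ⟨Lip0.rankOne g e, rankOne_mem X E g e⟩ ≤ g.lip * ‖e‖
  lip_le_norm : ∀ (X : Type u) [MetricSpace X] [Zero X] (E : Type u) [NormedAddCommGroup E]
    [NormedSpace 𝕜 E] [CompleteSpace E] (f : carrier X E), f.1.lip ≤ norm X E f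
  complete : ∀ (X : Type u) [MetricSpace X] [Zero X] (E : Type u) [NormedAddCommGroup E]
    [NormedSpace 𝕜 E] [CompleteSpace E] (s : ℕ → carrier X E),
    (∀ ε > 0, ∃ N, ∀ m ≥ N, ∀ n ≥ N, norm X E (s m - s n) < ε) →
      ∃ f : carrier X E, Filter.Tendsto (fun n => norm X E (s n - f)) Filter.atTop (nhds 0)
  comp_mem : ∀ (Z X : Type u) [MetricSpace Z] [Zero Z] [MetricSpace X] [Zero X]
    (E F : Type u) [NormedAddCommGroup E] [NormedSpace 𝕜 E] [CompleteSpace E]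
    [NormedAddCommGroup F] [NormedSpace 𝕜 F] [CompleteSpace F]
    (S : E →L[𝕜] F) (f : carrier X E) (h : Lip0 Z X),
    (Lip0.ofCLM S).comp (f.1.comp h) ∈ carrier Z F
  norm_comp_le : ∀ (Z X : Type u) [MetricSpace Z] [Zero Z] [MetricSpace X] [Zero X]
    (E F : Type u) [NormedAddCommGroup E] [NormedSpace 𝕜 E] [CompleteSpace E]
    [NormedAddCommGroup F] [NormedSpace 𝕜 F] [CompleteSpace F]
    (S : E →L[𝕜] F) (f : carrier X E) (h : Lip0 Z X),
    norm Z F ⟨(Lip0.ofCLM S).comp (f.1.comp h), comp_mem Z X E F S f h⟩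
      ≤ ‖S‖ * norm X E f * h.lip

namespace GenericLipIdeal

variable {𝕜 : Type} [RCLike 𝕜]

open Classical in
/-- `‖f‖_A` as an extended number: it is `∞` if `f` does not belong to `A(X, E)`. -/
def extNorm (A : GenericLipIdeal.{u} 𝕜) {X : Type u} [MetricSpace X] [Zero X]
    {E : Type u} [NormedAddCommGroup E] [NormedSpace 𝕜 E] [CompleteSpace E] (f : Lip0 X E) :
    ENNReal :=
  if hf : f ∈ A.carrier X E then ENNReal.ofReal (A.norm X E ⟨f, hf⟩) else ⊤

/-- `‖f‖_{A^max}`: the supremum of `‖Q ∘ f ∘ I‖_A`, `I : Y → X` the inclusion of a finite pointed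
subset and `Q : E → E/L` the projection for a closed subspace `L` of finite codimension. -/
def maxNorm (A : GenericLipIdeal.{u} 𝕜) {X : Type u} [MetricSpace X] [Zero X]
    {E : Type u} [NormedAddCommGroup E] [NormedSpace 𝕜 E] [CompleteSpace E] (f : Lip0 X E) :
    ENNReal :=
  ⨆ (Y : MFin X) (L : CofinSub 𝕜 E), A.extNorm ((Lip0.ofCLM L.proj).comp (f.comp Y.incl))

/-- `A` coincides with its maximal hull `A^max = {f | ‖f‖_{A^max} < ∞}`, with equal norms. -/
def IsMaximal (A : GenericLipIdeal.{u} 𝕜) : Prop :=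
  ∀ (X : Type u) [MetricSpace X] [Zero X] (E : Type u) [NormedAddCommGroup E] [NormedSpace 𝕜 E]
    [CompleteSpace E] (f : Lip0 X E),
    (f ∈ A.carrier X E ↔ A.maxNorm f < ⊤) ∧
      ∀ hf : f ∈ A.carrier X E, ENNReal.ofReal (A.norm X E ⟨f, hf⟩) = A.maxNorm f

/-- The ideal property of a strong ideal, for compositions `g ∘ f ∘ h` with Lipschitz `g`. -/
def IsStrong (A : GenericLipIdeal.{u} 𝕜) : Prop :=
  ∀ (Z X : Type u) [MetricSpace Z] [Zero Z] [MetricSpace X] [Zero X]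
    (E F : Type u) [NormedAddCommGroup E] [NormedSpace 𝕜 E] [CompleteSpace E]
    [NormedAddCommGroup F] [NormedSpace 𝕜 F] [CompleteSpace F]
    (g : Lip0 E F) (f : A.carrier X E) (h : Lip0 Z X),
    ∃ hm : g.comp (f.1.comp h) ∈ A.carrier Z F,
      A.norm Z F ⟨g.comp (f.1.comp h), hm⟩ ≤ g.lip * A.norm X E f * h.lip

/-- `A ∼ α`: for finite `X` and finite-dimensional `E`, `A(X, E*) = Lip_α(X, E*)` isometrically. -/
def IsAssociated (A : GenericLipIdeal.{u} 𝕜) (α : GenericLipCrossNorm.{u} 𝕜) : Prop :=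
  ∀ (X : Type u) [MetricSpace X] [Zero X] [Finite X] (E : Type u) [NormedAddCommGroup E]
    [NormedSpace 𝕜 E] [CompleteSpace E] [FiniteDimensional 𝕜 E] (f : Lip0 X (StrongDual 𝕜 E)),
    (f ∈ A.carrier X (StrongDual 𝕜 E) ↔ ∃ C, (α.norm X E).IsLipBound f C) ∧
      ∀ hf : f ∈ A.carrier X (StrongDual 𝕜 E),
        A.norm X (StrongDual 𝕜 E) ⟨f, hf⟩ = (α.norm X E).lipNorm f

/-- `f ∈ A(X, Y)` for a map between pointed metric spaces: `δ_Y ∘ f ∈ A(X, 𝓕(Y))`. -/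
def MemMetric (A : GenericLipIdeal.{u} 𝕜) {X Y : Type u} [MetricSpace X] [Zero X] [MetricSpace Y]
    [Zero Y] (f : Lip0 X Y) : Prop :=
  (freeEmb 𝕜 Y).comp f ∈ A.carrier X (FreeSpace 𝕜 Y)

/-- `‖f‖_A = ‖δ_Y ∘ f‖_A` for `f ∈ A(X, Y)`, `X` and `Y` pointed metric spaces. -/
def metricNorm (A : GenericLipIdeal.{u} 𝕜) {X Y : Type u} [MetricSpace X] [Zero X]
    [MetricSpace Y] [Zero Y] (f : Lip0 X Y) (hf : A.MemMetric f) : ℝ :=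
  A.norm X (FreeSpace 𝕜 Y) ⟨(freeEmb 𝕜 Y).comp f, hf⟩

end GenericLipIdeal

end

/-!
Regard `δ_Y` as a map into the dual of `Y^#`. Every `g ∈ Lip₀(Y, G*)` factors through it: the
transpose `gᵗ : G → Y^#`, `e ↦ ⟨g(·), e⟩`, has norm at most `Lip(g)`, so its adjoint restricts to a
linear extension of `g` to `𝓕(Y)` of norm at most `Lip(g)`.

Since `(X ⊠_π E)* = Lip₀(X, E*)`, the bound `π((f ⊠ id) u) ≤ C α(u)` says that `|u(g ∘ f)| ≤ C α(u)`
for all `g ∈ Lip₀(Y, G*)` with `Lip(g) ≤ 1`. If `δ_Y ∘ f` lies in `A`, so does `g ∘ f`, with norm at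
most `‖f‖_A`; as `A` and `α` are associated and `α` is finitely generated, this is a bound for the
functional `u ↦ u(g ∘ f)`. Conversely, the bound for `G = Y^#` and `g = δ_Y` carries over along the
transpose of `Y → 𝓕(Y)**` to a bound for `δ_Y ∘ f`, seen as a map into `𝓕(Y)**`, on `X ⊠ 𝓕(Y)*`.
It passes to all finite pieces `Q_L ∘ δ_Y ∘ f|_Z`, which take values in the finite-dimensional,
hence reflexive, spaces `𝓕(Y)/L`, so that they lie in `A`; by maximality `δ_Y ∘ f` lies in `A`.
-/

noncomputable section

theorem le_mul_sInf_of_forall_le_mul {s : Set ℝ} (hs : s.Nonempty) {a c : ℝ} (hc : 0 ≤ c)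
    (h : ∀ r ∈ s, a ≤ c * r) : a ≤ c * sInf s := by
  rw [← smul_eq_mul, ← Real.sInf_smul_of_nonneg hc]
  refine le_csInf hs.smul_set ?_
  rintro _ ⟨r, hr, rfl⟩
  exact h r hr

section NormedSpace

variable {𝕜 E F : Type*} [RCLike 𝕜] [NormedAddCommGroup E] [NormedSpace 𝕜 E]
  [NormedAddCommGroup F] [NormedSpace 𝕜 F]

theorem norm_precomp_le (G : Type*) [NormedAddCommGroup G] [NormedSpace 𝕜 G] (T : E →L[𝕜] F) :
    ‖(ContinuousLinearMap.precomp G T : (F →L[𝕜] G) →L[𝕜] E →L[𝕜] G)‖ ≤ ‖T‖ :=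
  ContinuousLinearMap.opNorm_le_bound _ (norm_nonneg T) fun φ =>
    (φ.opNorm_comp_le T).trans_eq (mul_comm _ _)

variable (𝕜 E) [FiniteDimensional 𝕜 E]

theorem finrank_strongDual : Module.finrank 𝕜 (StrongDual 𝕜 E) = Module.finrank 𝕜 E :=
  (LinearMap.toContinuousLinearMap (𝕜 := 𝕜) (E := E) (F' := 𝕜)).finrank_eq.symm.trans
    Subspace.dual_finrank_eq

/-- The canonical isometry of a finite-dimensional normed space onto its double dual. -/
def doubleDualEquiv : E ≃ₗᵢ[𝕜] StrongDual 𝕜 (StrongDual 𝕜 E) :=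
  (NormedSpace.inclusionInDoubleDualLi 𝕜).toLinearIsometryEquiv
    (by rw [finrank_strongDual, finrank_strongDual])

end NormedSpace

namespace Lip0

section Metric

variable {X Y Z : Type*} [MetricSpace X] [Zero X] [MetricSpace Y] [Zero Y] [MetricSpace Z] [Zero Z]

theorem lip_comp_le (g : Lip0 Y Z) (f : Lip0 X Y) : (g.comp f).lip ≤ g.lip * f.lip :=
  lip_le (mul_nonneg g.lip_nonneg f.lip_nonneg) fun x y => by
    calc dist (g (f x)) (g (f y)) ≤ g.lip * dist (f x) (f y) := g.dist_le _ _
      _ ≤ g.lip * (f.lip * dist x y) := by gcongr; exacts [g.lip_nonneg, f.dist_le x y]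
      _ = g.lip * f.lip * dist x y := (mul_assoc _ _ _).symm

variable (X) in
/-- The identity map of a pointed metric space. -/
def id : Lip0 X X := ⟨fun x => x, rfl, 1, zero_le_one, fun _ _ => (one_mul _).ge⟩

theorem lip_id_le : (Lip0.id X).lip ≤ 1 := lip_le zero_le_one fun _ _ => (one_mul _).ge

end Metric

section Normed

variable {𝕜 X Y E F : Type*} [RCLike 𝕜] [MetricSpace X] [Zero X] [MetricSpace Y] [Zero Y]
  [NormedAddCommGroup E] [NormedSpace 𝕜 E] [NormedAddCommGroup F] [NormedSpace 𝕜 F]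

theorem lip_ofCLM_le (T : E →L[𝕜] F) : (ofCLM T).lip ≤ ‖T‖ :=
  lip_le (norm_nonneg T) fun x y => by
    rw [dist_eq_norm, dist_eq_norm, ofCLM_apply, ofCLM_apply, ← map_sub]
    exact T.le_opNorm _

theorem pullback_eq_comp (h : Lip0 X Y) (T : E →L[𝕜] F) (g : Lip0 Y (StrongDual 𝕜 F)) :
    pullback h T g = (ofCLM (ContinuousLinearMap.precomp 𝕜 T)).comp (g.comp h) :=
  rfl

/-- The transpose `gᵗ : E → X^#`, `e ↦ (x ↦ ⟨g x, e⟩)`, of a Lipschitz map `g : X → E*`. -/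
def transpose (g : Lip0 X (StrongDual 𝕜 E)) : E →L[𝕜] LipDual 𝕜 X :=
  LinearMap.mkContinuous
    { toFun := fun e => (ofCLM (NormedSpace.inclusionInDoubleDual 𝕜 E e)).comp g
      map_add' := fun e e' => Lip0.ext fun x => map_add (g x) e e'
      map_smul' := fun c e => Lip0.ext fun x => map_smul (g x) c e } g.lip fun e => by
    calc _ ≤ (ofCLM (NormedSpace.inclusionInDoubleDual 𝕜 E e)).lip * g.lip := lip_comp_le _ _
      _ ≤ ‖e‖ * g.lip := by
        gcongr
        · exact g.lip_nonneg
        · exact (lip_ofCLM_le _).trans (NormedSpace.double_dual_bound 𝕜 E e)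
      _ = g.lip * ‖e‖ := mul_comm _ _

theorem norm_transpose_le (g : Lip0 X (StrongDual 𝕜 E)) : ‖g.transpose‖ ≤ g.lip :=
  LinearMap.mkContinuous_norm_le _ g.lip_nonneg _

end Normed

end Lip0

theorem MFin.lip_incl_le {X : Type*} [MetricSpace X] [Zero X] (Z : MFin X) : Z.incl.lip ≤ 1 :=
  Lip0.lip_le zero_le_one fun _ _ => (one_mul _).ge

theorem CofinSub.norm_proj_le {𝕜 E : Type*} [RCLike 𝕜] [NormedAddCommGroup E] [NormedSpace 𝕜 E]
    (L : CofinSub 𝕜 E) : ‖L.proj‖ ≤ 1 :=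
  L.proj.opNorm_le_bound zero_le_one fun e =>
    (Submodule.Quotient.norm_mk_le L.carrier e).trans_eq (one_mul _).symm

namespace FreeSpace

variable {𝕜 X Y E : Type*} [RCLike 𝕜] [MetricSpace X] [Zero X] [MetricSpace Y] [Zero Y]
  [NormedAddCommGroup E] [NormedSpace 𝕜 E]

variable (𝕜 Y) in
/-- The inclusion of `𝓕(Y)` in the dual of `Y^#`. -/
def incl : FreeSpace 𝕜 Y →L[𝕜] StrongDual 𝕜 (LipDual 𝕜 Y) :=
  (freeSubmodule 𝕜 Y).subtypeL

theorem norm_incl_le : ‖incl 𝕜 Y‖ ≤ 1 :=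
  (freeSubmodule 𝕜 Y).norm_subtypeL_le

theorem lip_freeEmb_le : (freeEmb 𝕜 Y).lip ≤ 1 :=
  Lip0.lip_le zero_le_one fun x y => by
    rw [one_mul, dist_eq_norm]
    refine ContinuousLinearMap.opNorm_le_bound _ dist_nonneg fun g => ?_
    rw [mul_comm]
    exact g.norm_sub_le x y

theorem lip_ofCLM_comp_freeEmb_le {T : FreeSpace 𝕜 Y →L[𝕜] E} (hT : ‖T‖ ≤ 1) :
    ((Lip0.ofCLM T).comp (freeEmb 𝕜 Y)).lip ≤ 1 :=
  (Lip0.lip_comp_le _ _).trans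
    (mul_le_one₀ ((Lip0.lip_ofCLM_le T).trans hT) (Lip0.lip_nonneg _) lip_freeEmb_le)

/-- The linear extension to `𝓕(Y)` of a Lipschitz map with values in a dual space, the adjoint of
its transpose. -/
def lift (g : Lip0 Y (StrongDual 𝕜 E)) : FreeSpace 𝕜 Y →L[𝕜] StrongDual 𝕜 E :=
  (ContinuousLinearMap.precomp 𝕜 g.transpose).comp (incl 𝕜 Y)

theorem norm_lift_le (g : Lip0 Y (StrongDual 𝕜 E)) : ‖lift g‖ ≤ g.lip :=
  calc ‖lift g‖ ≤ ‖ContinuousLinearMap.precomp 𝕜 g.transpose‖ * ‖incl 𝕜 Y‖ :=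
        ContinuousLinearMap.opNorm_comp_le _ _
    _ ≤ g.lip * 1 := by
        gcongr
        exacts [g.lip_nonneg, (norm_precomp_le 𝕜 _).trans g.norm_transpose_le, norm_incl_le]
    _ = g.lip := mul_one _

theorem lift_comp_freeEmb (g : Lip0 Y (StrongDual 𝕜 E)) :
    (Lip0.ofCLM (lift g)).comp (freeEmb 𝕜 Y) = g :=
  rfl

theorem pullback_transpose_incl_comp_freeEmb (h : Lip0 X Y) (g : Lip0 Y (StrongDual 𝕜 E)) :
    Lip0.pullback h g.transpose ((Lip0.ofCLM (incl 𝕜 Y)).comp (freeEmb 𝕜 Y)) = g.comp h :=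
  rfl

end FreeSpace

section TensorDuality

variable {𝕜 X Y E F : Type*} [RCLike 𝕜] [MetricSpace X] [Zero X] [MetricSpace Y] [Zero Y]
  [NormedAddCommGroup E] [NormedSpace 𝕜 E] [NormedAddCommGroup F] [NormedSpace 𝕜 F]

theorem LipTensor.hom_ext {M : Type*} [AddCommGroup M] [Module 𝕜 M] {φ ψ : LipTensor 𝕜 X E →ₗ[𝕜] M}
    (h : ∀ x y e, φ (LipTensor.mk 𝕜 x y e) = ψ (LipTensor.mk 𝕜 x y e)) : φ = ψ := by
  refine LinearMap.ext_on Submodule.span_span_coe_preimage ?_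
  rintro ⟨-, _⟩ ⟨x, y, e, rfl⟩
  exact h x y e

theorem LipTensor.map_coe_apply (h : Lip0 X Y) (T : E →L[𝕜] F) (u : LipTensor 𝕜 X E)
    (g : Lip0 Y (StrongDual 𝕜 F)) : (LipTensor.map h T u).1 g = u.1 (Lip0.pullback h T g) :=
  rfl

namespace LipTensorNormed

variable (α : LipCrossNorm 𝕜 X E)

/-- The bounded linear map `e ↦ δ_(x,y) ⊠ e` from `E` to `X ⊠_α E`. -/
def mkL (x y : X) : E →L[𝕜] LipTensorNormed α :=
  LinearMap.mkContinuous
    { toFun := fun e => of α (LipTensor.mk 𝕜 x y e)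
      map_add' := fun e e' => Subtype.ext <| LinearMap.ext fun f => map_add (f x - f y) e e'
      map_smul' := fun c e => Subtype.ext <| LinearMap.ext fun f => map_smul (f x - f y) c e }
    (dist x y) fun e => (α.cross' x y e).le

theorem norm_mkL_le (x y : X) : ‖mkL α x y‖ ≤ dist x y :=
  LinearMap.mkContinuous_norm_le _ dist_nonneg _

theorem mkL_self (x : X) : mkL α x x = 0 :=
  norm_le_zero_iff.1 ((norm_mkL_le α x x).trans_eq (dist_self x))

theorem mkL_sub_mkL (x y z : X) : mkL α x z - mkL α y z = mkL α x y := by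
  ext e
  refine Subtype.ext <| LinearMap.ext fun f => ?_
  change (f x - f z) e - (f y - f z) e = (f x - f y) e
  rw [← sub_apply, sub_sub_sub_cancel_right]

variable {α}

theorem exists_lip_le_and_apply_of_eq (φ : StrongDual 𝕜 (LipTensorNormed α)) :
    ∃ g : Lip0 X (StrongDual 𝕜 E), g.lip ≤ ‖φ‖ ∧ ∀ u, φ (of α u) = u.1 g := by
  let a (x : X) : StrongDual 𝕜 E := φ.comp (mkL α x 0)
  have a_sub (x y : X) : a x - a y = φ.comp (mkL α x y) := by
    rw [← ContinuousLinearMap.comp_sub, mkL_sub_mkL]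
  have norm_a_sub_le (x y : X) : ‖a x - a y‖ ≤ ‖φ‖ * dist x y := by
    rw [a_sub]
    exact (φ.opNorm_comp_le _).trans (by gcongr; exact norm_mkL_le α x y)
  have a_zero : a 0 = 0 := by simp only [a, mkL_self, ContinuousLinearMap.comp_zero]
  let g := Lip0.mkNorm a a_zero ‖φ‖ (norm_nonneg φ) norm_a_sub_le
  have apply_eq : φ.toLinearMap ∘ₗ (of α).toLinearMap
      = LinearMap.applyₗ g ∘ₗ (lipTensor 𝕜 X E).subtype :=
    LipTensor.hom_ext fun x y e => DFunLike.congr_fun (a_sub x y).symm e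
  exact ⟨g, Lip0.lip_le (norm_nonneg φ) fun x y => (dist_eq_norm _ _).trans_le (norm_a_sub_le x y),
    LinearMap.congr_fun apply_eq⟩

end LipTensorNormed

theorem LipTensor.projNorm_le_iff {u : LipTensor 𝕜 X E} {C : ℝ} :
    u.projNorm ≤ C ↔ ∀ g : Lip0 X (StrongDual 𝕜 E), g.lip ≤ 1 → ‖u.1 g‖ ≤ C := by
  refine ⟨fun h g hg => ?_, fun h => ?_⟩
  · exact (u.norm_apply_le_projNorm g).trans
      ((mul_le_of_le_one_left u.projNorm_nonneg hg).trans h)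
  · obtain ⟨φ, hφ, hφu⟩ := exists_dual_vector'' 𝕜
      (LipTensorNormed.of (LipCrossNorm.proj 𝕜 X E) u)
    obtain ⟨g, hg, hgφ⟩ := LipTensorNormed.exists_lip_le_and_apply_of_eq φ
    calc u.projNorm = ‖φ (LipTensorNormed.of (LipCrossNorm.proj 𝕜 X E) u)‖ := by
          rw [hφu, RCLike.norm_ofReal, abs_norm]; rfl
      _ = ‖u.1 g‖ := by rw [hgφ]
      _ ≤ C := h g (hg.trans hφ)

namespace LipCrossNorm

variable {α : LipCrossNorm 𝕜 X E} {f : Lip0 X (StrongDual 𝕜 E)} {C D : ℝ}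

theorem IsLipBound.mono (h : α.IsLipBound f C) (hCD : C ≤ D) : α.IsLipBound f D :=
  ⟨h.1.trans hCD, fun u => (h.2 u).trans (by gcongr)⟩

theorem lipNorm_le (h : α.IsLipBound f C) : α.lipNorm f ≤ C :=
  csInf_le ⟨0, fun _ hC => hC.1⟩ h

theorem isLipBound_lipNorm (h : ∃ C, α.IsLipBound f C) : α.IsLipBound f (α.lipNorm f) := by
  refine ⟨Real.sInf_nonneg fun _ hC => hC.1, fun u => ?_⟩
  rw [mul_comm]
  exact le_mul_sInf_of_forall_le_mul h (apply_nonneg α.toSeminorm u) fun C hC =>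
    (hC.2 u).trans_eq (mul_comm _ _)

theorem projNorm_map_le_iff {h : Lip0 X Y} {T : E →L[𝕜] F} (hC : 0 ≤ C) :
    (∀ u, (LipTensor.map h T u).projNorm ≤ C * α u) ↔
      ∀ g : Lip0 Y (StrongDual 𝕜 F), g.lip ≤ 1 → α.IsLipBound (Lip0.pullback h T g) C := by
  simp only [LipTensor.projNorm_le_iff, LipTensor.map_coe_apply, IsLipBound, hC, true_and]
  exact ⟨fun H g hg u => H u g hg, fun H u g hg => H g hg u⟩

end LipCrossNorm

theorem LipTensorCompl.norm_of (α : LipCrossNorm 𝕜 X E) (u : LipTensor 𝕜 X E) :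
    ‖LipTensorCompl.of α u‖ = α u :=
  UniformSpace.Completion.norm_coe _

section Extension

variable {α : LipCrossNorm 𝕜 X E} {β : LipCrossNorm 𝕜 Y F} {h : Lip0 X Y} {S : E →L[𝕜] F}

theorem exists_isTensorExtension_norm_le {C : ℝ} (hC : 0 ≤ C)
    (hb : ∀ u, β (LipTensor.map h S u) ≤ C * α u) :
    ∃ T, IsTensorExtension α β h S T ∧ ‖T‖ ≤ C := by
  let T : LipTensorNormed α →L[𝕜] LipTensorNormed β :=
    LinearMap.mkContinuous ((LipTensorNormed.of β).toLinearMap ∘ₗ LipTensor.map h S ∘ₗ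
      (LipTensorNormed.of α).symm.toLinearMap) C hb
  refine ⟨T.completion, fun u => T.completion_apply_coe _, ?_⟩
  refine T.completion.opNorm_le_bound hC fun v => ?_
  induction v using UniformSpace.Completion.induction_on with
  | hp => exact isClosed_le (by fun_prop) (by fun_prop)
  | ih w =>
    rw [ContinuousLinearMap.completion_apply_coe, UniformSpace.Completion.norm_coe,
      UniformSpace.Completion.norm_coe]
    exact hb w

theorem IsTensorExtension.le_opNorm {T : LipTensorCompl α →L[𝕜] LipTensorCompl β}
    (hT : IsTensorExtension α β h S T) (u : LipTensor 𝕜 X E) :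
    β (LipTensor.map h S u) ≤ ‖T‖ * α u := by
  have := T.le_opNorm (LipTensorCompl.of α u)
  rwa [hT u, LipTensorCompl.norm_of, LipTensorCompl.norm_of] at this

end Extension

end TensorDuality

namespace GenericLipCrossNorm

variable {𝕜 : Type} [RCLike 𝕜] {α : GenericLipCrossNorm.{u} 𝕜} {X Y E F : Type u} [MetricSpace X]
  [Zero X] [MetricSpace Y] [Zero Y] [NormedAddCommGroup E] [NormedSpace 𝕜 E] [CompleteSpace E]
  [NormedAddCommGroup F] [NormedSpace 𝕜 F] [CompleteSpace F] {C : ℝ}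

theorem isLipBound_pullback {g : Lip0 Y (StrongDual 𝕜 F)} (hg : (α.norm Y F).IsLipBound g C)
    (h : Lip0 X Y) (T : E →L[𝕜] F) :
    (α.norm X E).IsLipBound (Lip0.pullback h T g) (C * (h.lip * ‖T‖)) := by
  refine ⟨mul_nonneg hg.1 (mul_nonneg h.lip_nonneg (norm_nonneg T)), fun u => ?_⟩
  calc ‖(LipTensor.map h T u).1 g‖ ≤ C * α.norm Y F (LipTensor.map h T u) := hg.2 _
    _ ≤ C * (h.lip * ‖T‖ * α.norm X E u) := by
      gcongr; exacts [hg.1, α.metric_mapping X Y E F h T u]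
    _ = C * (h.lip * ‖T‖) * α.norm X E u := (mul_assoc _ _ _).symm

theorem isLipBound_pullback_of_le_one {g : Lip0 Y (StrongDual 𝕜 F)}
    (hg : (α.norm Y F).IsLipBound g C) {h : Lip0 X Y} (hh : h.lip ≤ 1) {T : E →L[𝕜] F}
    (hT : ‖T‖ ≤ 1) : (α.norm X E).IsLipBound (Lip0.pullback h T g) C :=
  (isLipBound_pullback hg h T).mono
    (mul_le_of_le_one_right hg.1 (mul_le_one₀ hh (norm_nonneg T) hT))

theorem FinitelyGenerated.isLipBound (hfg : α.FinitelyGenerated) {f : Lip0 X (StrongDual 𝕜 E)}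
    (hC : 0 ≤ C)
    (h : ∀ (X₀ : MFin X) (E₀ : FinSub 𝕜 E),
      (α.norm X₀ E₀).IsLipBound (Lip0.pullback X₀.incl E₀.carrier.subtypeL f) C) :
    (α.norm X E).IsLipBound f C := by
  refine ⟨hC, fun u => ?_⟩
  have norm_eq := hfg X E u
  obtain hs | hs := Set.eq_empty_or_nonempty {r : ℝ | ∃ (X₀ : MFin X) (E₀ : FinSub 𝕜 E)
    (u₀ : LipTensor 𝕜 X₀ E₀), LipTensor.map X₀.incl E₀.carrier.subtypeL u₀ = u ∧
      r = α.norm X₀ E₀ u₀}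
  · -- `sInf ∅ = 0`, so here `u = 0`.
    rw [hs, Real.sInf_empty] at norm_eq
    simp only [(α.norm X E).eq_zero' u norm_eq, ZeroMemClass.coe_zero, LinearMap.zero_apply,
      norm_zero, map_zero, mul_zero, le_refl]
  · rw [norm_eq]
    refine le_mul_sInf_of_forall_le_mul hs hC ?_
    rintro _ ⟨X₀, E₀, u₀, rfl, rfl⟩
    exact (h X₀ E₀).2 u₀

end GenericLipCrossNorm

namespace GenericLipIdeal

variable {𝕜 : Type} [RCLike 𝕜] {A : GenericLipIdeal.{u} 𝕜} {α : GenericLipCrossNorm.{u} 𝕜}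
  {X Y Z : Type u} [MetricSpace X] [Zero X] [MetricSpace Y] [Zero Y] [MetricSpace Z] [Zero Z]
  {E F : Type u} [NormedAddCommGroup E] [NormedSpace 𝕜 E] [CompleteSpace E]
  [NormedAddCommGroup F] [NormedSpace 𝕜 F] [CompleteSpace F] {C D : ℝ}

variable (A) in
/-- `f` lies in the closed ball of radius `C` of the Banach space `A(X, E)`; this bundles membership
in `A(X, E)` with a bound for `‖f‖_A`. -/
def InBall (f : Lip0 X E) (C : ℝ) : Prop :=
  ∃ hf : f ∈ A.carrier X E, A.norm X E ⟨f, hf⟩ ≤ C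

namespace InBall

variable {f : Lip0 X E}

theorem nonneg (hf : A.InBall f C) : 0 ≤ C := (apply_nonneg _ _).trans hf.2

theorem mono (hf : A.InBall f C) (hCD : C ≤ D) : A.InBall f D := ⟨hf.1, hf.2.trans hCD⟩

theorem comp (hf : A.InBall f C) (S : E →L[𝕜] F) (h : Lip0 Z X) :
    A.InBall ((Lip0.ofCLM S).comp (f.comp h)) (‖S‖ * C * h.lip) := by
  refine ⟨A.comp_mem Z X E F S ⟨f, hf.1⟩ h, (A.norm_comp_le Z X E F S ⟨f, hf.1⟩ h).trans ?_⟩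
  gcongr
  exacts [h.lip_nonneg, hf.2]

theorem comp_of_le_one (hf : A.InBall f C) {S : E →L[𝕜] F} (hS : ‖S‖ ≤ 1) {h : Lip0 Z X}
    (hh : h.lip ≤ 1) : A.InBall ((Lip0.ofCLM S).comp (f.comp h)) C :=
  (hf.comp S h).mono ((mul_le_of_le_one_right (mul_nonneg (norm_nonneg S) hf.nonneg) hh).trans
    (mul_le_of_le_one_left hf.nonneg hS))

theorem postcomp (hf : A.InBall f C) {S : E →L[𝕜] F} (hS : ‖S‖ ≤ 1) :
    A.InBall ((Lip0.ofCLM S).comp f) C :=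
  hf.comp_of_le_one hS Lip0.lip_id_le

end InBall

theorem extNorm_le_ofReal_iff {f : Lip0 X E} (hC : 0 ≤ C) :
    A.extNorm f ≤ ENNReal.ofReal C ↔ A.InBall f C := by
  by_cases hf : f ∈ A.carrier X E
  · simp [extNorm, InBall, hf, ENNReal.ofReal_le_ofReal_iff hC]
  · simp [extNorm, InBall, hf]

theorem IsMaximal.extNorm_eq_maxNorm (hmax : A.IsMaximal) (f : Lip0 X E) :
    A.extNorm f = A.maxNorm f := by
  by_cases hf : f ∈ A.carrier X E
  · rw [extNorm, dif_pos hf, (hmax X E f).2 hf]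
  · rw [extNorm, dif_neg hf]
    exact (not_lt_top_iff.1 (mt (hmax X E f).1.2 hf)).symm

theorem IsMaximal.inBall_iff (hmax : A.IsMaximal) {f : Lip0 X E} (hC : 0 ≤ C) :
    A.InBall f C ↔ ∀ (Z : MFin X) (L : CofinSub 𝕜 E),
      A.InBall ((Lip0.ofCLM L.proj).comp (f.comp Z.incl)) C := by
  rw [← extNorm_le_ofReal_iff hC, hmax.extNorm_eq_maxNorm, maxNorm]
  simp only [iSup_le_iff, extNorm_le_ofReal_iff hC]

theorem IsAssociated.inBall_iff_isLipBound (hassoc : A.IsAssociated α) [Finite X]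
    [FiniteDimensional 𝕜 E] {f : Lip0 X (StrongDual 𝕜 E)} :
    A.InBall f C ↔ (α.norm X E).IsLipBound f C := by
  obtain ⟨mem_iff, norm_eq⟩ := hassoc X E f
  refine ⟨fun ⟨hf, hle⟩ => ?_, fun h => ?_⟩
  · exact (LipCrossNorm.isLipBound_lipNorm (mem_iff.1 hf)).mono ((norm_eq hf).symm.trans_le hle)
  · exact ⟨mem_iff.2 ⟨C, h⟩, (norm_eq _).trans_le (LipCrossNorm.lipNorm_le h)⟩

theorem InBall.isLipBound {f : Lip0 X (StrongDual 𝕜 E)} (hf : A.InBall f C)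
    (hfg : α.FinitelyGenerated) (hassoc : A.IsAssociated α) : (α.norm X E).IsLipBound f C := by
  refine hfg.isLipBound hf.nonneg fun X₀ E₀ => hassoc.inBall_iff_isLipBound.1 ?_
  rw [Lip0.pullback_eq_comp]
  exact hf.comp_of_le_one ((norm_precomp_le 𝕜 _).trans (Submodule.norm_subtypeL_le _))
    X₀.lip_incl_le

theorem IsAssociated.inBall_of_isLipBound_doubleDual (hassoc : A.IsAssociated α) [Finite X]
    [FiniteDimensional 𝕜 E] {f : Lip0 X E}
    (h : (α.norm X (StrongDual 𝕜 E)).IsLipBound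
      ((Lip0.ofCLM (NormedSpace.inclusionInDoubleDual 𝕜 E)).comp f) C) :
    A.InBall f C := by
  let J := doubleDualEquiv 𝕜 E
  have inBall_symm_comp := (hassoc.inBall_iff_isLipBound.2 h).postcomp
    J.symm.toLinearIsometry.norm_toContinuousLinearMap_le
  convert inBall_symm_comp using 1
  exact Lip0.ext fun x => (J.symm_apply_apply (f x)).symm

theorem IsMaximal.inBall_of_isLipBound_doubleDual (hmax : A.IsMaximal)
    (hassoc : A.IsAssociated α) {f : Lip0 X E}
    (h : (α.norm X (StrongDual 𝕜 E)).IsLipBound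
      ((Lip0.ofCLM (NormedSpace.inclusionInDoubleDual 𝕜 E)).comp f) C) :
    A.InBall f C := by
  refine (hmax.inBall_iff h.1).2 fun Z L => hassoc.inBall_of_isLipBound_doubleDual ?_
  exact GenericLipCrossNorm.isLipBound_pullback_of_le_one h Z.lip_incl_le
    ((norm_precomp_le 𝕜 L.proj).trans L.norm_proj_le)

theorem InBall.projNorm_map_le {f : Lip0 X Y} (hf : A.InBall ((freeEmb 𝕜 Y).comp f) C)
    (hfg : α.FinitelyGenerated) (hassoc : A.IsAssociated α) (u : LipTensor 𝕜 X E) :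
    (LipTensor.map f (ContinuousLinearMap.id 𝕜 E) u).projNorm ≤ C * α.norm X E u := by
  refine (LipCrossNorm.projNorm_map_le_iff hf.nonneg).2 (fun g hg => ?_) u
  have inBall_comp : A.InBall (g.comp f) C := by
    rw [← FreeSpace.lift_comp_freeEmb g]
    exact hf.postcomp ((FreeSpace.norm_lift_le g).trans hg)
  exact inBall_comp.isLipBound hfg hassoc

theorem IsMaximal.inBall_freeEmb_comp (hmax : A.IsMaximal) (hassoc : A.IsAssociated α)
    {f : Lip0 X Y} (hC : 0 ≤ C)
    (h : ∀ u : LipTensor 𝕜 X (LipDual 𝕜 Y),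
      (LipTensor.map f (ContinuousLinearMap.id 𝕜 (LipDual 𝕜 Y)) u).projNorm
        ≤ C * α.norm X (LipDual 𝕜 Y) u) :
    A.InBall ((freeEmb 𝕜 Y).comp f) C := by
  have isLipBound_eval := (LipCrossNorm.projNorm_map_le_iff hC).1 h _
    (FreeSpace.lip_ofCLM_comp_freeEmb_le FreeSpace.norm_incl_le)
  let J : Lip0 Y (StrongDual 𝕜 (StrongDual 𝕜 (FreeSpace 𝕜 Y))) :=
    (Lip0.ofCLM (𝕜 := 𝕜) (NormedSpace.inclusionInDoubleDual 𝕜 (FreeSpace 𝕜 Y))).comp (freeEmb 𝕜 Y)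
  have lip_J_le : J.lip ≤ 1 :=
    FreeSpace.lip_ofCLM_comp_freeEmb_le (NormedSpace.inclusionInDoubleDual_norm_le 𝕜 _)
  have isLipBound_J :
      (α.norm X (StrongDual 𝕜 (FreeSpace 𝕜 Y))).IsLipBound (J.comp f) C := by
    rw [← FreeSpace.pullback_transpose_incl_comp_freeEmb]
    exact GenericLipCrossNorm.isLipBound_pullback_of_le_one isLipBound_eval Lip0.lip_id_le
      (J.norm_transpose_le.trans lip_J_le)
  exact hmax.inBall_of_isLipBound_doubleDual hassoc isLipBound_J

end GenericLipIdeal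

end

theorem mainTheorem5_general {𝕜 : Type} [RCLike 𝕜]
    (A : GenericLipIdeal.{u} 𝕜) (hmax : A.IsMaximal)
    (α : GenericLipCrossNorm.{u} 𝕜) (hfg : α.FinitelyGenerated) (hassoc : A.IsAssociated α)
    (X Y : Type u) [MetricSpace X] [Zero X] [MetricSpace Y] [Zero Y] (f : Lip0 X Y) :
    (A.MemMetric f ↔
      ∀ (G : Type u) [NormedAddCommGroup G] [NormedSpace 𝕜 G] [CompleteSpace G],
        ∃ T, IsTensorExtension (α.norm X G) (LipCrossNorm.proj 𝕜 Y G) f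
          (ContinuousLinearMap.id 𝕜 G) T) ∧
    (A.MemMetric f ↔
      ∃ T, IsTensorExtension (α.norm X (LipDual 𝕜 Y)) (LipCrossNorm.proj 𝕜 Y (LipDual 𝕜 Y)) f
        (ContinuousLinearMap.id 𝕜 (LipDual 𝕜 Y)) T) ∧
    (∀ hf : A.MemMetric f,
      ∃ T, IsTensorExtension (α.norm X (LipDual 𝕜 Y)) (LipCrossNorm.proj 𝕜 Y (LipDual 𝕜 Y)) f
          (ContinuousLinearMap.id 𝕜 (LipDual 𝕜 Y)) T ∧
        A.metricNorm f hf = ‖T‖ ∧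
        ∀ (G : Type u) [NormedAddCommGroup G] [NormedSpace 𝕜 G] [CompleteSpace G],
          ∃ T', IsTensorExtension (α.norm X G) (LipCrossNorm.proj 𝕜 Y G) f
              (ContinuousLinearMap.id 𝕜 G) T' ∧ ‖T'‖ ≤ ‖T‖) := by
  have exists_extension (hf : A.MemMetric f) (G : Type u) [NormedAddCommGroup G]
      [NormedSpace 𝕜 G] [CompleteSpace G] : ∃ T, IsTensorExtension (α.norm X G)
        (LipCrossNorm.proj 𝕜 Y G) f (ContinuousLinearMap.id 𝕜 G) T ∧ ‖T‖ ≤ A.metricNorm f hf :=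
    exists_isTensorExtension_norm_le (apply_nonneg _ _)
      (GenericLipIdeal.InBall.projNorm_map_le ⟨hf, le_rfl⟩ hfg hassoc)
  have inBall {T} (hT : IsTensorExtension (α.norm X (LipDual 𝕜 Y))
      (LipCrossNorm.proj 𝕜 Y (LipDual 𝕜 Y)) f (ContinuousLinearMap.id 𝕜 (LipDual 𝕜 Y)) T) :
      A.InBall ((freeEmb 𝕜 Y).comp f) ‖T‖ :=
    hmax.inBall_freeEmb_comp hassoc (norm_nonneg T) hT.le_opNorm
  refine ⟨⟨fun hf G _ _ _ => (exists_extension hf G).imp fun _ => And.left, fun h => ?_⟩,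
    ⟨fun hf => (exists_extension hf _).imp fun _ => And.left, fun ⟨T, hT⟩ => (inBall hT).1⟩,
    fun hf => ?_⟩
  · obtain ⟨T, hT⟩ := h (LipDual 𝕜 Y)
    exact (inBall hT).1
  · obtain ⟨T, hT, norm_le⟩ := exists_extension hf (LipDual 𝕜 Y)
    have norm_eq : A.metricNorm f hf = ‖T‖ := le_antisymm (inBall hT).2 norm_le
    exact ⟨T, hT, norm_eq, fun G _ _ _ => norm_eq ▸ exists_extension hf G⟩

theorem mainTheorem5 {𝕜 : Type} [RCLike 𝕜]
    (A : GenericLipIdeal.{u} 𝕜) (hstrong : A.IsStrong) (hmax : A.IsMaximal)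
    (α : GenericLipCrossNorm.{u} 𝕜) (hfg : α.FinitelyGenerated) (hassoc : A.IsAssociated α)
    (X Y : Type u) [MetricSpace X] [Zero X] [MetricSpace Y] [Zero Y] (f : Lip0 X Y) :
    (A.MemMetric f ↔
      ∀ (G : Type u) [NormedAddCommGroup G] [NormedSpace 𝕜 G] [CompleteSpace G],
        ∃ T, IsTensorExtension (α.norm X G) (LipCrossNorm.proj 𝕜 Y G) f
          (ContinuousLinearMap.id 𝕜 G) T) ∧
    (A.MemMetric f ↔
      ∃ T, IsTensorExtension (α.norm X (LipDual 𝕜 Y)) (LipCrossNorm.proj 𝕜 Y (LipDual 𝕜 Y)) f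
        (ContinuousLinearMap.id 𝕜 (LipDual 𝕜 Y)) T) ∧
    (∀ hf : A.MemMetric f,
      ∃ T, IsTensorExtension (α.norm X (LipDual 𝕜 Y)) (LipCrossNorm.proj 𝕜 Y (LipDual 𝕜 Y)) f
          (ContinuousLinearMap.id 𝕜 (LipDual 𝕜 Y)) T ∧
        A.metricNorm f hf = ‖T‖ ∧
        ∀ (G : Type u) [NormedAddCommGroup G] [NormedSpace 𝕜 G] [CompleteSpace G],
          ∃ T', IsTensorExtension (α.norm X G) (LipCrossNorm.proj 𝕜 Y G) f
              (ContinuousLinearMap.id 𝕜 G) T' ∧ ‖T'‖ ≤ ‖T‖) :=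
  mainTheorem5_general A hmax α hfg hassoc X Y f
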